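/- A *real Laurent polynomial of degree at most $m$* is a function $f(z)=\sum_{k=-m}^{m}a_kz^k$ on $\mathbb C\setminus\{0\}$, $a_k\in\mathbb C$, whose values on the unit circle $S=\{|z|=1\}$ are real. These functions form a finite-dimensional real vector space, with the scalar product $(f,g)=\frac1{2\pi}\int_0^{2\pi}f(e^{i\theta})g(e^{i\theta})\,d\theta$. A *random real Laurent polynomial of degree $m$*, denoted $f_m$, is an element of this space distributed according to the standard normal distribution associated with this scalar product (so its coordinates in any orthonormal basis are independent standard normal variables). A root of $f$ in $\mathbb C\setminus\{0\}$ is called *real* if it lies on $S$. For $m\ge 1$ let $\mathcal P(f_m)$ be the probability that a root of $f_m$ is real, that is, the expectation of the quotient of the number of real roots of $f_m$ by the number of all roots of $f_m$ in $\mathbb C\setminus\{0\}$. Then, whether roots are counted once or with multiplicity: (a) for every $m\ge 0$, the number of real roots of $f_m$ is integrable and its expectation is $2\sqrt{\frac{m(m+1)}{3}}$; (b) for every $m\ge 1$, $\mathcal P(f_m)=\sqrt{\frac{m+1}{3m}}$; (c) $\lim_{m\to\infty}\mathcal P(f_m)=\frac1{\sqrt3}$. -/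

import Mathlib

open scoped LaurentPolynomial

noncomputable section

/-- The value `∑ aₖ zᵏ` of a complex Laurent polynomial at `z` (meaningful for `z ≠ 0`). -/
def laurentEval (f : ℂ[T;T⁻¹]) (z : ℂ) : ℂ :=
  f.coeff.sum fun k a => a * z ^ k

theorem laurentEval_add (f g : ℂ[T;T⁻¹]) (z : ℂ) :
    laurentEval (f + g) z = laurentEval f z + laurentEval g z := by
  unfold laurentEval
  rw [AddMonoidAlgebra.coeff_add]
  exact Finsupp.sum_add_index' (by simp) (by intros; ring)

theorem laurentEval_zero (z : ℂ) : laurentEval 0 z = 0 := by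
  simp [laurentEval]

theorem laurentEval_smul (c : ℝ) (f : ℂ[T;T⁻¹]) (z : ℂ) :
    laurentEval (c • f) z = c * laurentEval f z := by
  unfold laurentEval
  rw [AddMonoidAlgebra.coeff_smul, Finsupp.sum_smul_index' (by simp), Finsupp.mul_sum]
  simp [mul_assoc]

theorem laurentEval_unit (f : ℂ[T;T⁻¹]) (u : ℂˣ) :
    laurentEval f u = LaurentPolynomial.eval₂ (RingHom.id ℂ) u f := by
  induction f using LaurentPolynomial.induction_on' with
  | add p q hp hq => rw [laurentEval_add, map_add, hp, hq]
  | C_mul_T n a =>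
    rw [LaurentPolynomial.eval₂_C_mul_T, ← LaurentPolynomial.single_eq_C_mul_T,
      laurentEval, AddMonoidAlgebra.coeff_single, Finsupp.sum_single_index (zero_mul _)]
    simp

/-- A Laurent polynomial that vanishes on an arc of the unit circle is zero. -/
theorem eq_zero_of_laurentEval_circle (f : ℂ[T;T⁻¹])
    (h : ∀ θ ∈ Set.Ioc (0 : ℝ) 1, laurentEval f (Complex.exp (θ * Complex.I)) = 0) : f = 0 := by
  obtain ⟨n, p, hp⟩ := LaurentPolynomial.exists_T_pow f
  have hp0 : p = 0 := by
    refine Polynomial.eq_zero_of_infinite_isRoot p ?_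
    refine Set.Infinite.mono (s := (fun x : ℝ => Complex.exp (x * Complex.I)) '' Set.Ioc 0 1) ?_ ?_
    · rintro _ ⟨x, hx, rfl⟩
      have hu := laurentEval_unit f (Units.mk0 _ (Complex.exp_ne_zero (x * Complex.I)))
      have h1 := congrArg (LaurentPolynomial.eval₂ (RingHom.id ℂ)
        (Units.mk0 _ (Complex.exp_ne_zero (x * Complex.I)))) hp
      rw [map_mul, ← hu, Units.val_mk0, h x hx, zero_mul, LaurentPolynomial.eval₂_toLaurent] at h1
      simpa [Polynomial.IsRoot, Polynomial.eval₂_id] using h1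
    · refine (Set.Ioc_infinite (zero_lt_one' ℝ)).image ?_
      intro x hx y hy hxy
      have hxy' : Complex.exp (x * Complex.I) = Complex.exp (y * Complex.I) := hxy
      have hpi := Real.pi_gt_three
      have hx' : (x * Complex.I : ℂ).im = x := by simp
      have hy' : (y * Complex.I : ℂ).im = y := by simp
      have := Complex.exp_inj_of_neg_pi_lt_of_le_pi (x := x * Complex.I) (y := y * Complex.I)
        (by rw [hx']; linarith [hx.1]) (by rw [hx']; linarith [hx.2])
        (by rw [hy']; linarith [hy.1]) (by rw [hy']; linarith [hy.2]) hxy'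
      rw [← hx', ← hy', this]
  rw [hp0, map_zero] at hp
  have hT : (LaurentPolynomial.T n * LaurentPolynomial.T (-n) : ℂ[T;T⁻¹]) = 1 := by
    rw [← LaurentPolynomial.T_add, add_neg_cancel, LaurentPolynomial.T_zero]
  rw [← mul_one f, ← hT, ← mul_assoc, ← hp, zero_mul]

theorem continuous_laurentEval_circle (f : ℂ[T;T⁻¹]) :
    Continuous fun θ : ℝ => laurentEval f (Complex.exp (θ * Complex.I)) := by
  unfold laurentEval Finsupp.sum
  refine continuous_finsetSum _ fun k _ => continuous_const.mul ?_
  exact Continuous.zpow₀ (by fun_prop) k fun θ => Or.inl (Complex.exp_ne_zero _)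

/-- The real vector space of real Laurent polynomials of degree at most `m`: those with
spectrum in `{-m, …, m}` whose values on the unit circle are real. -/
def realLaurent (m : ℕ) : Submodule ℝ ℂ[T;T⁻¹] where
  carrier := {f | (∀ k ∈ f.coeff.support, |k| ≤ (m : ℤ)) ∧
    ∀ z : ℂ, ‖z‖ = 1 → (laurentEval f z).im = 0}
  zero_mem' := by simp [laurentEval_zero]
  add_mem' := by
    rintro f g ⟨hf, hf'⟩ ⟨hg, hg'⟩
    refine ⟨fun k hk => ?_, fun z hz => by simp [laurentEval_add, hf' z hz, hg' z hz]⟩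
    rw [AddMonoidAlgebra.coeff_add] at hk
    rcases Finset.mem_union.1 (Finsupp.support_add hk) with h | h
    exacts [hf k h, hg k h]
  smul_mem' := by
    rintro c f ⟨hf, hf'⟩
    refine ⟨fun k hk => ?_, fun z hz => by simp [laurentEval_smul, hf' z hz]⟩
    rw [AddMonoidAlgebra.coeff_smul] at hk
    exact hf k (Finsupp.support_smul hk)

namespace realLaurent

/-- The restriction of a real Laurent polynomial to the unit circle, as a real function of the
angle (a trigonometric polynomial). -/
def trig {m : ℕ} (f : realLaurent m) (θ : ℝ) : ℝ :=
  (laurentEval f (Complex.exp (θ * Complex.I))).re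

theorem continuous_trig {m : ℕ} (f : realLaurent m) : Continuous (trig f) :=
  Complex.continuous_re.comp (continuous_laurentEval_circle f)

/-- The scalar product of `L₂` of the circle, `(f, g) = (1 / 2π) ∫ f g dθ`. -/
@[reducible]
def innerCore (m : ℕ) : InnerProductSpace.Core ℝ (realLaurent m) where
  inner f g := (1 / (2 * Real.pi)) * ∫ θ in (0 : ℝ)..2 * Real.pi, trig f θ * trig g θ
  conj_inner_symm f g := by simp [mul_comm]
  re_inner_nonneg f := by
    have : 0 ≤ ∫ θ in (0 : ℝ)..2 * Real.pi, trig f θ * trig f θ :=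
      intervalIntegral.integral_nonneg (by positivity) fun _ _ => mul_self_nonneg _
    simp only [RCLike.re_to_real]
    positivity
  add_left f g h := by
    rw [← mul_add, ← intervalIntegral.integral_add]
    · simp [trig, laurentEval_add, add_mul]
    · exact ((continuous_trig f).mul (continuous_trig h)).intervalIntegrable _ _
    · exact ((continuous_trig g).mul (continuous_trig h)).intervalIntegrable _ _
  smul_left f g c := by
    simp only [trig, Submodule.coe_smul, laurentEval_smul, Complex.re_ofReal_mul, mul_assoc,
      intervalIntegral.integral_const_mul, conj_trivial]
    ring
  definite f hf := by
    have hpi := Real.pi_pos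
    have h0 : ∫ θ in (0 : ℝ)..2 * Real.pi, trig f θ * trig f θ = 0 := by
      rcases mul_eq_zero.1 hf with h | h
      · exact absurd h (by positivity)
      · exact h
    have hc : Continuous fun θ => trig f θ * trig f θ :=
      (continuous_trig f).mul (continuous_trig f)
    have hz : ∀ θ ∈ Set.Ico 0 (2 * Real.pi), trig f θ = 0 := by
      intro θ hθ
      by_contra hne
      have : 0 < ∫ θ in (0 : ℝ)..2 * Real.pi, trig f θ * trig f θ :=
        intervalIntegral.integral_pos (by positivity) hc.continuousOn
          (fun _ _ => mul_self_nonneg _) ⟨θ, ⟨hθ.1, hθ.2.le⟩, mul_self_pos.2 hne⟩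
      linarith
    refine Subtype.ext (eq_zero_of_laurentEval_circle f fun θ hθ => Complex.ext ?_ ?_)
    · exact hz θ ⟨hθ.1.le, by linarith [hθ.2, Real.pi_gt_three]⟩
    · exact f.2.2 _ (Complex.norm_exp_ofReal_mul_I θ)

instance (m : ℕ) : NormedAddCommGroup (realLaurent m) := (innerCore m).toNormedAddCommGroup

instance (m : ℕ) : InnerProductSpace ℝ (realLaurent m) := .ofCore (innerCore m).toCore

instance (m : ℕ) : FiniteDimensional ℝ (realLaurent m) := by
  let φ : realLaurent m →ₗ[ℝ] (Finset.Icc (-(m : ℤ)) m → ℂ) :=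
    { toFun := fun f k => f.1.coeff k
      map_add' := fun f g => by ext k; simp
      map_smul' := fun c f => by ext k; simp }
  refine FiniteDimensional.of_injective φ fun f g hfg => ?_
  apply Subtype.ext
  apply AddMonoidAlgebra.coeff_injective
  ext1 k
  by_cases hk : k ∈ Finset.Icc (-(m : ℤ)) m
  · exact congrFun hfg ⟨k, hk⟩
  · have h : ∀ f : realLaurent m, f.1.coeff k = 0 := fun f => by
      by_contra hne
      exact hk (Finset.mem_Icc.2 (abs_le.1 (f.2.1 k (Finsupp.mem_support_iff.2 hne))))
    rw [h f, h g]

instance (m : ℕ) : MeasurableSpace (realLaurent m) := borel _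

instance (m : ℕ) : BorelSpace (realLaurent m) := ⟨rfl⟩

end realLaurent

/-- The law of a random real Laurent polynomial of degree `m`: the standard normal distribution
for the `L₂` scalar product. -/
abbrev randomLaurent (m : ℕ) : MeasureTheory.Measure (realLaurent m) :=
  ProbabilityTheory.stdGaussian (realLaurent m)

/-- The roots of a Laurent polynomial in `ℂ ∖ 0`. -/
def laurentRoots (f : ℂ[T;T⁻¹]) : Set ℂ := {z | z ≠ 0 ∧ laurentEval f z = 0}

/-- The roots on the unit circle, called the real roots. -/
def laurentRealRoots (f : ℂ[T;T⁻¹]) : Set ℂ := {z ∈ laurentRoots f | ‖z‖ = 1}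

/-- The two usual ways to count roots. -/
inductive RootCounting
  | distinct
  | withMultiplicity

/-- The number of elements of a set `R` of roots of `f`, each one counted once or with its
multiplicity as a zero of `f`. Both are `0` by convention for an infinite set `R`, which occurs
only for `f = 0`. -/
def countRoots (f : ℂ[T;T⁻¹]) (R : Set ℂ) : RootCounting → ℕ
  | .distinct => R.ncard
  | .withMultiplicity => ∑ᶠ z ∈ R, analyticOrderNatAt (laurentEval f) z

/-- The probability that a root of a random real Laurent polynomial of degree `m` is real: the
mean of the probability that a root of `f`, chosen uniformly among all roots of `f`, is real. -/
def realRootProbability (m : ℕ) (c : RootCounting) : ℝ :=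
  ∫ f : realLaurent m, (countRoots f (laurentRealRoots f) c : ℝ) / countRoots f (laurentRoots f) c
    ∂randomLaurent m

end

open MeasureTheory ProbabilityTheory Set Topology ComplexConjugate

/-! On the circle, `f` takes the value `⟨f, e + u(θ)⟩`, where `e` is the constant `1`, a unit
vector, and `u(θ) ⊥ e` represents evaluation of the remaining terms. The curve `u` lies on a sphere
with `‖u‖² = U = 2m`; its derivative `w` is orthogonal to `u` and `‖w‖² = W = m(m+1)(2m+1)/3`.

The component of `f` along `e` may be replaced by an independent standard normal `a`
(`stdGaussian_eq_map_prod`). With the rest `g` of `f` frozen, the real roots are the solutions of `a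
= -⟨g, u(θ)⟩`. Averaging their number over `a` is an area formula (`lintegral_encard_fiber_mul`) and
gives `∫ |⟨g, w⟩| φ(-⟨g, u⟩) dθ`, with `φ` the standard normal density. For fixed `θ` the two
factors are independent because `u ⊥ w`, with means `√(2W/π)` and `1/√(2π(1+U))`. Integrating the
product over `[0, 2π)` gives `2√(W/(1+U))`, which is (a) for `m ≥ 1`
(`lintegral_encard_zeros_stdGaussian`).

For (b), the leading coefficient is almost surely nonzero, and the same resampling shows that almost
surely there are no multiple roots (`ae_roots_simple`): `z f'(z)` does not involve the constant term
and has finitely many zeros, so only finitely many constant terms make one of them a root of `f`.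
Hence the two ways of counting agree, the total is `2m` (`ncard_laurentRoots`), and the mean
quotient is the mean number of real roots divided by `2m`. -/

/-! ### The area formula on the line. -/

/-- The points at which a strictly differentiable function has nonzero derivative are covered by
countably many open sets on which the function is injective. -/
theorem exists_countable_cover_injOn {g g' : ℝ → ℝ} (hg : ∀ x, HasStrictDerivAt g (g' x) x) :
    ∃ V : ℕ → Set ℝ, (∀ n, IsOpen (V n)) ∧ (∀ n, InjOn g (V n)) ∧ {x | g' x ≠ 0} ⊆ ⋃ n, V n := by
  have hloc : ∀ x, ∃ U : Set ℝ, IsOpen U ∧ InjOn g U ∧ (g' x ≠ 0 → x ∈ U) := by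
    intro x
    by_cases hx : g' x = 0
    · exact ⟨∅, isOpen_empty, injOn_empty g, fun h => absurd hx h⟩
    · let e := ((hg x).hasStrictFDerivAt_equiv hx).toOpenPartialHomeomorph g
      exact ⟨e.source, e.open_source, e.injOn,
        fun _ => ((hg x).hasStrictFDerivAt_equiv hx).mem_toOpenPartialHomeomorph_source⟩
  choose U hUo hUi hUm using hloc
  obtain ⟨C, -, hCc, hC⟩ := TopologicalSpace.countable_cover_nhdsWithin (f := U)
    (s := {x | g' x ≠ 0}) fun x hx => mem_nhdsWithin_of_mem_nhds ((hUo x).mem_nhds (hUm x hx))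
  -- The set `∅` is added because only a nonempty countable family is the range of a sequence.
  obtain ⟨V, hV⟩ := ((hCc.image U).insert ∅).exists_eq_range (insert_nonempty _ _)
  have hmem : ∀ n, V n = ∅ ∨ ∃ x ∈ C, U x = V n := fun n => by
    have : V n ∈ insert ∅ (U '' C) := hV ▸ mem_range_self n
    simpa using this
  refine ⟨V, fun n => ?_, fun n => ?_, fun x hx => ?_⟩
  · rcases hmem n with h | ⟨x, -, h⟩
    · rw [h]; exact isOpen_empty
    · rw [← h]; exact hUo x
  · rcases hmem n with h | ⟨x, -, h⟩
    · rw [h]; exact injOn_empty g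
    · rw [← h]; exact hUi x
  · obtain ⟨y, hy, hxy⟩ := mem_iUnion₂.1 (hC hx)
    have : U y ∈ range V := hV ▸ mem_insert_of_mem _ (mem_image_of_mem U hy)
    obtain ⟨n, hn⟩ := this
    exact mem_iUnion.2 ⟨n, hn ▸ hxy⟩

/-- The area formula on the line, with the number of preimages. -/
theorem lintegral_encard_fiber_mul {g g' : ℝ → ℝ} (hg : ∀ x, HasStrictDerivAt g (g' x) x)
    (hg' : Measurable g') {s : Set ℝ} (hs : MeasurableSet s) {φ : ℝ → ENNReal}
    (hφ : Measurable φ) :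
    ∫⁻ y, ((s ∩ g ⁻¹' {y}).encard : ENNReal) * φ y =
      ∫⁻ x in s, ENNReal.ofReal |g' x| * φ (g x) := by
  obtain ⟨V, hVo, hVi, hVc⟩ := exists_countable_cover_injOn hg
  have hgc : Continuous g := continuous_iff_continuousAt.2 fun x => (hg x).hasDerivAt.continuousAt
  let r : Set ℝ := {x | g' x ≠ 0}
  have hr : MeasurableSet r := hg' (measurableSet_singleton 0).compl
  -- A measurable partition of the noncritical points of `s` into pieces on which `g` is injective.
  let t : ℕ → Set ℝ := fun n => s ∩ r ∩ disjointed V n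
  have htm : ∀ n, MeasurableSet (t n) := fun n =>
    (hs.inter hr).inter (MeasurableSet.disjointed (fun i => (hVo i).measurableSet) n)
  have htd : Pairwise (Function.onFun Disjoint t) := fun i j hij =>
    (disjoint_disjointed V hij).mono inter_subset_right inter_subset_right
  have hti : ∀ n, InjOn g (t n) := fun n =>
    (hVi n).mono (inter_subset_right.trans (disjointed_subset V n))
  have htu : ⋃ n, t n = s ∩ r := by
    rw [← inter_iUnion, iUnion_disjointed, inter_eq_left]
    exact inter_subset_right.trans hVc
  have him : ∀ n, MeasurableSet (g '' t n) := fun n =>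
    (htm n).image_of_continuousOn_injOn hgc.continuousOn (hti n)
  -- Sard's theorem in dimension one: critical values can be ignored in the integral over `y`.
  have hcrit : volume (g '' rᶜ) = 0 := by
    refine addHaar_image_eq_zero_of_det_fderivWithin_eq_zero volume
      (fun x _ => (hg x).hasDerivAt.hasFDerivAt.hasFDerivWithinAt) fun x hx => ?_
    have hx0 : g' x = 0 := not_not.1 hx
    simp [hx0, ContinuousLinearMap.det]
  have hcount : ∀ y ∉ g '' rᶜ,
      ((s ∩ g ⁻¹' {y}).encard : ENNReal) = ∑' n, (g '' t n).indicator 1 y := by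
    intro y hy
    have hfib : MeasurableSet (g ⁻¹' {y}) := hgc.measurable (measurableSet_singleton y)
    have hsr : s ∩ g ⁻¹' {y} = ⋃ n, t n ∩ g ⁻¹' {y} := by
      rw [← iUnion_inter, htu]
      ext x
      constructor
      · rintro ⟨hxs, hxy⟩
        refine ⟨⟨hxs, ?_⟩, hxy⟩
        by_contra hxr
        exact hy ⟨x, hxr, hxy⟩
      · rintro ⟨⟨hxs, -⟩, hxy⟩
        exact ⟨hxs, hxy⟩
    rw [← Measure.count_apply (hs.inter hfib), hsr, measure_iUnion
      (fun i j hij => (htd hij).mono inter_subset_left inter_subset_left)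
      fun n => (htm n).inter hfib]
    refine tsum_congr fun n => ?_
    rw [Measure.count_apply ((htm n).inter hfib)]
    by_cases hyn : y ∈ g '' t n
    · obtain ⟨x, hx, rfl⟩ := hyn
      have : t n ∩ g ⁻¹' {g x} = {x} := by
        ext z
        constructor
        · rintro ⟨hz, hzx⟩
          exact hti n hz hx hzx
        · rintro rfl
          exact ⟨hx, rfl⟩
      rw [this, encard_singleton, indicator_of_mem (mem_image_of_mem g hx)]
      simp
    · have : t n ∩ g ⁻¹' {y} = ∅ := by
        ext z
        simp only [mem_inter_iff, mem_preimage, mem_singleton_iff, mem_empty_iff_false, iff_false]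
        rintro ⟨hz, hzy⟩
        exact hyn ⟨z, hz, hzy⟩
      rw [this, encard_empty, indicator_of_notMem hyn]
      simp
  calc
    ∫⁻ y, ((s ∩ g ⁻¹' {y}).encard : ENNReal) * φ y
        = ∫⁻ y, ∑' n, (g '' t n).indicator φ y := by
          refine lintegral_congr_ae ?_
          filter_upwards [compl_mem_ae_iff.2 hcrit] with y hy
          rw [hcount y hy, ← ENNReal.tsum_mul_right]
          refine tsum_congr fun n => ?_
          by_cases hyn : y ∈ g '' t n <;> simp [indicator, hyn]
    _ = ∑' n, ∫⁻ x in t n, ENNReal.ofReal |g' x| * φ (g x) := by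
          rw [lintegral_tsum fun n => (hφ.indicator (him n)).aemeasurable]
          refine tsum_congr fun n => ?_
          rw [lintegral_indicator (him n), lintegral_image_eq_lintegral_abs_deriv_mul (htm n)
            (fun x _ => (hg x).hasDerivAt.hasDerivWithinAt) (hti n)]
    _ = ∫⁻ x in s ∩ r, ENNReal.ofReal |g' x| * φ (g x) := by
          rw [← lintegral_iUnion htm htd, htu]
    _ = ∫⁻ x in s, ENNReal.ofReal |g' x| * φ (g x) := by
          rw [← lintegral_indicator (hs.inter hr), ← lintegral_indicator hs]
          refine lintegral_congr fun x => ?_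
          by_cases hx : g' x = 0
          · simp [indicator, hx]
          · have hxr : x ∈ r := hx
            by_cases hxs : x ∈ s <;> simp [indicator, hxs, hxr]

/-! ### Measurability of the number of zeros. -/

/-- Parameters for which a jointly continuous function takes a given value on a compact set form a
closed set. -/
theorem isClosed_setOf_exists_mem_isCompact {X Y Z : Type*} [TopologicalSpace X]
    [TopologicalSpace Y] [TopologicalSpace Z] [T1Space Z] {F : X → Y → Z} {K : Set Y}
    (hK : IsCompact K) (hF : ContinuousOn (fun p : X × Y => F p.1 p.2) (univ ×ˢ K)) (z : Z) :
    IsClosed {x | ∃ y ∈ K, F x y = z} := by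
  have : CompactSpace K := isCompact_iff_compactSpace.1 hK
  have hc : Continuous fun p : K × X => F p.2 p.1 :=
    hF.comp_continuous (f := fun p : K × X => (p.2, (p.1 : Y))) (by fun_prop)
      fun p => ⟨mem_univ _, p.1.2⟩
  have := isClosedMap_snd_of_compactSpace _ (isClosed_singleton.preimage hc (t := {z}))
  convert this using 1
  ext x
  simp

/-- The number of points of a set of reals is the supremum of the number of cells of the uniform
grids that it meets. -/
theorem encard_eq_iSup_floor (S : Set ℝ) :
    S.encard = ⨆ n : ℕ, ((fun x : ℝ => ⌊x * n⌋) '' S).encard := by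
  apply le_antisymm
  · refine ENat.forall_natCast_le_iff_le.1 fun k hk => ?_
    obtain ⟨t, htS, htk⟩ := exists_subset_encard_eq hk
    have htf : t.Finite := finite_of_encard_eq_coe htk
    -- A mesh at most the smallest gap of the finite set `t` puts its points into distinct cells.
    obtain ⟨n, hn⟩ : ∃ n : ℕ, ∀ p ∈ t ×ˢ t, p.1 < p.2 → 1 ≤ (p.2 - p.1) * n := by
      have hev : ∀ p ∈ t ×ˢ t, ∀ᶠ n : ℕ in Filter.atTop, p.1 < p.2 → 1 ≤ (p.2 - p.1) * n := by
        intro p _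
        by_cases hp : p.1 < p.2
        · filter_upwards [(tendsto_natCast_atTop_atTop (R := ℝ)).const_mul_atTop
            (sub_pos.2 hp) |>.eventually_ge_atTop 1] with n hn _ using hn
        · exact Filter.Eventually.of_forall fun n h => absurd h hp
      exact (((htf.prod htf).eventually_all).2 hev).exists
    have hinj : InjOn (fun x : ℝ => ⌊x * n⌋) t := by
      have hlt : ∀ x ∈ t, ∀ y ∈ t, x < y → ⌊x * n⌋ < ⌊y * n⌋ := by
        intro x hx y hy hxy
        have h1 := hn (x, y) ⟨hx, hy⟩ hxy
        have h2 : x * n + 1 ≤ y * n := by simp only at h1; linarith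
        have h3 := Int.floor_le_floor h2
        rw [Int.floor_add_one] at h3
        omega
      intro x hx y hy hxy
      rcases lt_trichotomy x y with h | h | h
      · exact absurd hxy (hlt x hx y hy h).ne
      · exact h
      · exact absurd hxy (hlt y hy x hx h).ne'
    calc (k : ℕ∞) = ((fun x : ℝ => ⌊x * n⌋) '' t).encard := by rw [hinj.encard_image, htk]
      _ ≤ ((fun x : ℝ => ⌊x * n⌋) '' S).encard := encard_le_encard (image_mono htS)
      _ ≤ _ := le_iSup (fun n : ℕ => ((fun x : ℝ => ⌊x * n⌋) '' S).encard) n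
  · exact iSup_le fun n => encard_image_le _ _

/-- The number of zeros on an interval of a jointly continuous function is a measurable function
of the parameter. -/
theorem measurable_encard_zeros {X : Type*} [TopologicalSpace X] [MeasurableSpace X]
    [OpensMeasurableSpace X] {F : X → ℝ → ℝ} (hF : Continuous fun p : X × ℝ => F p.1 p.2)
    (a b : ℝ) :
    Measurable fun x => (({θ ∈ Ico a b | F x θ = 0} : Set ℝ).encard : ENNReal) := by
  have hIco : ∀ c d : ℝ, MeasurableSet {x | ∃ θ ∈ Ico c d, F x θ = 0} := by
    intro c d
    -- Exhausting the half-open interval by compact ones makes the set a countable union of closed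
    -- sets.
    have : {x | ∃ θ ∈ Ico c d, F x θ = 0} =
        ⋃ n : ℕ, {x | ∃ θ ∈ Icc c (d - 1 / (n + 1)), F x θ = 0} := by
      ext x
      simp only [mem_ofPred_eq, mem_iUnion]
      constructor
      · rintro ⟨θ, ⟨h1, h2⟩, h⟩
        obtain ⟨n, hn⟩ := exists_nat_one_div_lt (sub_pos.2 h2)
        exact ⟨n, θ, ⟨h1, by linarith⟩, h⟩
      · rintro ⟨n, θ, ⟨h1, h2⟩, h⟩
        have : (0 : ℝ) < 1 / (n + 1) := by positivity
        exact ⟨θ, ⟨h1, by linarith⟩, h⟩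
    rw [this]
    exact MeasurableSet.iUnion fun n =>
      (isClosed_setOf_exists_mem_isCompact isCompact_Icc hF.continuousOn 0).measurableSet
  simp_rw [encard_eq_iSup_floor, ENat.toENNReal_iSup]
  refine Measurable.iSup fun n => ?_
  have hsum : ∀ x, ((((fun θ : ℝ => ⌊θ * n⌋) '' {θ ∈ Ico a b | F x θ = 0}).encard : ℕ∞) : ENNReal)
      = ∑' k : ℤ, {x | ∃ θ ∈ Ico a b, ⌊θ * n⌋ = k ∧ F x θ = 0}.indicator 1 x := by
    intro x
    rw [← Measure.count_apply (MeasurableSet.of_discrete), ← lintegral_indicator_one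
      (MeasurableSet.of_discrete), lintegral_count]
    refine tsum_congr fun k => ?_
    have hiff : k ∈ (fun θ : ℝ => ⌊θ * n⌋) '' {θ ∈ Ico a b | F x θ = 0} ↔
        x ∈ {x | ∃ θ ∈ Ico a b, ⌊θ * n⌋ = k ∧ F x θ = 0} := by
      simp only [mem_image, mem_ofPred_eq]
      grind
    by_cases h : x ∈ {x | ∃ θ ∈ Ico a b, ⌊θ * n⌋ = k ∧ F x θ = 0}
    · rw [indicator_of_mem h, indicator_of_mem (hiff.2 h)]; rfl
    · rw [indicator_of_notMem h, indicator_of_notMem (fun h' => h (hiff.1 h'))]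
  simp_rw [hsum]
  refine Measurable.tsum fun k => measurable_one.indicator ?_
  -- For `n = 0` every point falls into the single cell `k = 0`.
  rcases Nat.eq_zero_or_pos n with rfl | hn
  · by_cases hk : k = 0
    · simpa [hk] using hIco a b
    · simp [Ne.symm hk]
  · have hn' : (0 : ℝ) < n := by exact_mod_cast hn
    convert hIco (max a (k / n)) (min b ((k + 1) / n)) using 5 with x θ
    rw [Int.floor_eq_iff, ← div_le_iff₀ hn', ← lt_div_iff₀ hn', mem_Ico, mem_Ico, max_le_iff,
      lt_min_iff]
    tauto

/-! ### Standard normal vectors and the mean number of zeros. -/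

section Gaussian

variable {E : Type*} [NormedAddCommGroup E] [InnerProductSpace ℝ E] [FiniteDimensional ℝ E]
  [MeasurableSpace E] [BorelSpace E]

/-- Resampling the coordinate along a unit vector does not change the standard normal law. -/
theorem stdGaussian_eq_map_prod {e : E} (he : ‖e‖ = 1) :
    stdGaussian E = ((gaussianReal 0 1).prod (stdGaussian E)).map
      fun p => p.1 • e + (p.2 - inner ℝ e p.2 • e) := by
  have hm : Measurable fun p : ℝ × E => p.1 • e + (p.2 - inner ℝ e p.2 • e) := by fun_prop
  have : IsProbabilityMeasure (((gaussianReal 0 1).prod (stdGaussian E)).map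
      fun p : ℝ × E => p.1 • e + (p.2 - inner ℝ e p.2 • e)) :=
    Measure.isProbabilityMeasure_map hm.aemeasurable
  refine Measure.ext_of_charFun (funext fun t => ?_)
  rw [charFun_stdGaussian, charFun_apply, integral_map hm.aemeasurable
    (Measurable.aestronglyMeasurable (by fun_prop))]
  -- The component of `t` along `e` meets only the new coordinate, and its orthogonal part meets
  -- only the old vector; by Pythagoras the two characteristic functions multiply to the original
  -- one.
  have hsplit : ∀ p : ℝ × E,
      Complex.exp ((inner ℝ (p.1 • e + (p.2 - inner ℝ e p.2 • e)) t : ℝ) * Complex.I) =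
      Complex.exp ((inner ℝ e t : ℝ) * p.1 * Complex.I) *
        Complex.exp ((inner ℝ p.2 (t - inner ℝ e t • e) : ℝ) * Complex.I) := by
    intro p
    rw [← Complex.exp_add, inner_add_left, inner_sub_left, inner_sub_right, real_inner_smul_left,
      real_inner_smul_left, real_inner_smul_right, real_inner_comm p.2 e]
    congr 1
    push_cast
    ring
  simp_rw [hsplit]
  rw [integral_prod_mul (fun a : ℝ => Complex.exp ((inner ℝ e t : ℝ) * a * Complex.I))
    fun x : E => Complex.exp ((inner ℝ x (t - inner ℝ e t • e) : ℝ) * Complex.I),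
    ← charFun_apply_real, ← charFun_apply, charFun_gaussianReal, charFun_stdGaussian,
    ← Complex.exp_add]
  have hn : ‖t - inner ℝ e t • e‖ ^ 2 = ‖t‖ ^ 2 - inner ℝ e t ^ 2 := by
    rw [norm_sub_sq_real, norm_smul, real_inner_smul_right, he, real_inner_comm t e, mul_one,
      Real.norm_eq_abs, sq_abs]
    ring
  congr 1
  rw [← Complex.ofReal_pow ‖t - _‖, hn]
  push_cast
  simp
  ring

theorem stdGaussian_map_inner (w : E) :
    (stdGaussian E).map (fun f => inner ℝ f w) = gaussianReal 0 (‖w‖ ^ 2).toNNReal := by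
  have h := IsGaussian.map_eq_gaussianReal (μ := stdGaussian E) (innerSL ℝ w)
  rw [integral_strongDual_stdGaussian, variance_dual_stdGaussian, innerSL_apply_norm] at h
  rw [← h]
  congr 1
  ext f
  simp [real_inner_comm]

/-- A nonzero linear functional has a normal law of positive variance, which has no atoms. -/
theorem stdGaussian_inner_ne_zero {w : E} (hw : w ≠ 0) :
    ∀ᵐ f ∂stdGaussian E, inner ℝ f w ≠ 0 := by
  have hv : (‖w‖ ^ 2).toNNReal ≠ 0 := by
    have : 0 < ‖w‖ := norm_pos_iff.2 hw
    simpa using this.ne'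
  have := nullSingletonClass_gaussianReal (μ := 0) hv
  have h : ∀ᵐ x ∂((stdGaussian E).map fun f => inner ℝ f w), x ≠ 0 := by
    rw [stdGaussian_map_inner]
    exact compl_mem_ae_iff.2 (measure_singleton 0)
  exact ae_of_ae_map (f := fun f : E => (inner ℝ f w : ℝ)) (p := fun x => x ≠ 0) (by fun_prop) h

/-- The two functionals are jointly Gaussian with covariance `⟨u, w⟩`, and uncorrelated jointly
Gaussian variables are independent. -/
theorem indepFun_inner_stdGaussian {u w : E} (h : inner ℝ u w = 0) :
    IndepFun (fun f => inner ℝ f u) (fun f => inner ℝ f w) (stdGaussian E) := by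
  have hid : HasGaussianLaw (id : E → E) (stdGaussian E) := by
    have : IsGaussian ((stdGaussian E).map id) := by rw [Measure.map_id]; infer_instance
    exact IsGaussian.hasGaussianLaw
  have hlaw : HasGaussianLaw (fun f : E => ((inner ℝ f u : ℝ), (inner ℝ f w : ℝ)))
      (stdGaussian E) := by
    have hfun : (fun f : E => ((inner ℝ f u : ℝ), (inner ℝ f w : ℝ))) =
        (innerSL ℝ u).prod (innerSL ℝ w) ∘ id := by
      funext f
      simp [real_inner_comm f]
    rw [hfun]
    exact hid.map ((innerSL ℝ u).prod (innerSL ℝ w))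
  refine hlaw.indepFun_of_covariance_eq_zero ?_
  have hc := covarianceBilin_apply_eq_cov (μ := stdGaussian E) IsGaussian.memLp_two_id u w
  rw [covarianceBilin_stdGaussian, innerSL_apply_apply, h] at hc
  simp_rw [real_inner_comm u, real_inner_comm w]
  exact hc.symm

theorem lintegral_ofReal_abs_gaussianReal {W : ℝ} (hW : 0 ≤ W) :
    ∫⁻ x, ENNReal.ofReal |x| ∂(gaussianReal 0 W.toNNReal) =
      ENNReal.ofReal (Real.sqrt (2 * W / Real.pi)) := by
  rcases hW.eq_or_lt with rfl | hW
  · simp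
  have hv : W.toNNReal ≠ 0 := by simpa using hW
  have hint : Integrable (fun x : ℝ => |x|) (gaussianReal 0 W.toNNReal) :=
    (IsGaussian.integrable_id).abs
  rw [← ofReal_integral_eq_lintegral_ofReal hint
    (Filter.Eventually.of_forall fun x => abs_nonneg x),
    integral_gaussianReal_eq_integral_smul hv]
  congr 1
  simp only [gaussianPDFReal, sub_zero, smul_eq_mul, Real.coe_toNNReal W hW.le]
  have h1 : ∀ x : ℝ, (Real.sqrt (2 * Real.pi * W))⁻¹ * Real.exp (-x ^ 2 / (2 * W)) * |x| =
      (fun y => (Real.sqrt (2 * Real.pi * W))⁻¹ * (y ^ (1 : ℝ) *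
        Real.exp (-(1 / (2 * W)) * y ^ (2 : ℝ)))) |x| := by
    intro x
    simp only [Real.rpow_one, Real.rpow_two, sq_abs]
    rw [show -x ^ 2 / (2 * W) = -(1 / (2 * W)) * x ^ 2 by ring]
    ring
  rw [integral_congr_ae (Filter.Eventually.of_forall h1),
    integral_comp_abs (f := fun y => _ * (y ^ (1 : ℝ) * Real.exp (-(1 / (2 * W)) * y ^ (2 : ℝ)))),
    integral_const_mul, integral_rpow_mul_exp_neg_mul_rpow (by norm_num)
    (by norm_num) (by positivity)]
  have h2 : (-((1 : ℝ) + 1) / 2) = -1 := by norm_num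
  have h3 : (((1 : ℝ) + 1) / 2) = 1 := by norm_num
  rw [h2, h3, Real.Gamma_one, Real.rpow_neg_one]
  have hpi := Real.pi_pos
  symm
  rw [Real.sqrt_eq_iff_mul_self_eq_of_pos (by positivity)]
  have hs : Real.sqrt (2 * Real.pi * W) ^ 2 = 2 * Real.pi * W := Real.sq_sqrt (by positivity)
  field_simp
  rw [hs]

/-- The integral is the convolution of two centred normal densities at `0`, hence the density at `0`
of variance `1 + U`. -/
theorem lintegral_gaussianPDF_neg_gaussianReal {U : ℝ} (hU : 0 < U) :
    ∫⁻ x, gaussianPDF 0 1 (-x) ∂(gaussianReal 0 U.toNNReal) =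
      ENNReal.ofReal (Real.sqrt (1 / (2 * Real.pi * (1 + U)))) := by
  have hv : U.toNNReal ≠ 0 := by simpa using hU
  have hpi := Real.pi_pos
  have hpdf : Measurable fun x : ℝ => gaussianPDF 0 1 (-x) :=
    (measurable_gaussianPDF _ _).comp measurable_neg
  rw [gaussianReal_of_var_ne_zero _ hv, lintegral_withDensity_eq_lintegral_mul _
    (measurable_gaussianPDF _ _) hpdf]
  have h1 : ∀ x : ℝ, (gaussianPDF 0 U.toNNReal * fun x => gaussianPDF 0 1 (-x)) x =
      ENNReal.ofReal ((Real.sqrt (2 * Real.pi * U))⁻¹ * (Real.sqrt (2 * Real.pi))⁻¹ *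
        Real.exp (-((1 + U) / (2 * U)) * x ^ 2)) := by
    intro x
    rw [Pi.mul_apply, gaussianPDF, gaussianPDF, ← ENNReal.ofReal_mul (gaussianPDFReal_nonneg _ _ _)]
    simp only [gaussianPDFReal, sub_zero, Real.coe_toNNReal U hU.le, NNReal.coe_one, mul_one]
    congr 1
    rw [show -((1 + U) / (2 * U)) * x ^ 2 = -x ^ 2 / (2 * U) + -(-x) ^ 2 / 2 by field_simp; ring,
      Real.exp_add]
    ring
  simp_rw [h1]
  have hint : Integrable fun x : ℝ => Real.exp (-((1 + U) / (2 * U)) * x ^ 2) :=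
    integrable_exp_neg_mul_sq (by positivity)
  rw [← ofReal_integral_eq_lintegral_ofReal (hint.const_mul _)
    (Filter.Eventually.of_forall fun x => by positivity), integral_const_mul, integral_gaussian]
  congr 1
  rw [← Real.sqrt_inv, ← Real.sqrt_inv, ← Real.sqrt_mul (by positivity),
    ← Real.sqrt_mul (by positivity)]
  congr 1
  field_simp

/-- The expected number of zeros of `θ ↦ ⟨f, e + u θ⟩`, for a standard normal vector `f`, when
`u` runs over a sphere in the orthogonal complement of the unit vector `e` with constant speed. -/
theorem lintegral_encard_zeros_stdGaussian {e : E} (he : ‖e‖ = 1) {u w : ℝ → E} {U W : ℝ}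
    (hu : ∀ θ, HasStrictDerivAt u (w θ) θ) (hw : Continuous w) (hue : ∀ θ, inner ℝ e (u θ) = 0)
    (hU : 0 < U) (huU : ∀ θ, ‖u θ‖ ^ 2 = U) (hwW : ∀ θ, ‖w θ‖ ^ 2 = W)
    (huw : ∀ θ, inner ℝ (u θ) (w θ) = 0) (α β : ℝ) :
    ∫⁻ f, (({θ ∈ Ico α β | inner ℝ f (e + u θ) = 0} : Set ℝ).encard : ENNReal) ∂stdGaussian E =
      ENNReal.ofReal ((β - α) / Real.pi * Real.sqrt (W / (1 + U))) := by
  have hpi := Real.pi_pos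
  have hW : 0 ≤ W := hwW 0 ▸ sq_nonneg _
  have huc : Continuous u := continuous_iff_continuousAt.2 fun θ => (hu θ).hasDerivAt.continuousAt
  have hmeas : Measurable fun f : E =>
      (({θ ∈ Ico α β | inner ℝ f (e + u θ) = 0} : Set ℝ).encard : ENNReal) :=
    measurable_encard_zeros (F := fun f θ => inner ℝ f (e + u θ)) (by fun_prop) α β
  have hinner : ∀ (a : ℝ) (f : E) (θ : ℝ),
      inner ℝ (a • e + (f - inner ℝ e f • e)) (e + u θ) = a + inner ℝ f (u θ) := by
    intro a f θ
    simp only [inner_add_left, inner_sub_left, inner_add_right, real_inner_smul_left, hue θ,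
      real_inner_self_eq_norm_sq, he, real_inner_comm e f]
    ring
  have hfiber : ∀ f : E,
      ∫⁻ a, (({θ ∈ Ico α β | inner ℝ (a • e + (f - inner ℝ e f • e)) (e + u θ) = 0} :
        Set ℝ).encard : ENNReal) ∂gaussianReal 0 1 =
      ∫⁻ θ in Ico α β, ENNReal.ofReal |inner ℝ f (w θ)| * gaussianPDF 0 1 (-inner ℝ f (u θ)) := by
    intro f
    -- For frozen `f`, the zeros form the fibre of this function over `a`.
    have hg : ∀ θ, HasStrictDerivAt (fun θ => -inner ℝ f (u θ)) (-inner ℝ f (w θ)) θ := fun θ =>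
      ((innerSL ℝ f).hasStrictFDerivAt.comp_hasStrictDerivAt θ (hu θ)).neg
    have harea := lintegral_encard_fiber_mul hg (by fun_prop) (measurableSet_Ico (a := α) (b := β))
      (measurable_gaussianPDF 0 1)
    simp only [abs_neg] at harea
    rw [← harea, gaussianReal_of_var_ne_zero _ one_ne_zero,
      lintegral_withDensity_eq_lintegral_mul₀ (measurable_gaussianPDF _ _).aemeasurable]
    · refine lintegral_congr fun a => ?_
      rw [Pi.mul_apply, mul_comm]
      congr 3
      ext θ
      simp only [hinner, mem_ofPred_eq, mem_inter_iff, mem_preimage, mem_singleton_iff]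
      refine and_congr_right fun _ => ⟨fun h => by linarith, fun h => by linarith⟩
    · exact (hmeas.comp (by fun_prop : Measurable fun a : ℝ =>
        a • e + (f - inner ℝ e f • e))).aemeasurable
  have hθ : ∀ θ, ∫⁻ f, ENNReal.ofReal |inner ℝ f (w θ)| * gaussianPDF 0 1 (-inner ℝ f (u θ))
      ∂stdGaussian E = ENNReal.ofReal (1 / Real.pi * Real.sqrt (W / (1 + U))) := by
    intro θ
    have hind : IndepFun (fun f : E => ENNReal.ofReal |inner ℝ f (w θ)|)
        (fun f : E => gaussianPDF 0 1 (-inner ℝ f (u θ))) (stdGaussian E) :=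
      (indepFun_inner_stdGaussian (huw θ)).symm.comp
        (φ := fun x : ℝ => ENNReal.ofReal |x|) (ψ := fun x : ℝ => gaussianPDF 0 1 (-x))
        (by fun_prop) ((measurable_gaussianPDF _ _).comp measurable_neg)
    have hpdf : Measurable fun f : E => gaussianPDF 0 1 (-inner ℝ f (u θ)) :=
      (measurable_gaussianPDF _ _).comp (by fun_prop)
    have hmul := lintegral_mul_eq_lintegral_mul_lintegral_of_indepFun (by fun_prop) hpdf hind
    simp only [Pi.mul_apply] at hmul
    rw [hmul,
      ← lintegral_map (f := fun x : ℝ => ENNReal.ofReal |x|) (g := fun f : E => inner ℝ f (w θ))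
        (by fun_prop) (by fun_prop),
      ← lintegral_map (f := fun x : ℝ => gaussianPDF 0 1 (-x)) (g := fun f : E => inner ℝ f (u θ))
        ((measurable_gaussianPDF _ _).comp measurable_neg) (by fun_prop),
      stdGaussian_map_inner, stdGaussian_map_inner, huU, hwW, lintegral_ofReal_abs_gaussianReal hW,
      lintegral_gaussianPDF_neg_gaussianReal hU, ← ENNReal.ofReal_mul (Real.sqrt_nonneg _),
      ← Real.sqrt_mul (by positivity)]
    congr 1
    rw [show (1 : ℝ) / Real.pi = Real.sqrt ((1 / Real.pi) ^ 2) from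
      (Real.sqrt_sq (by positivity)).symm, ← Real.sqrt_mul (by positivity)]
    congr 1
    field_simp
  calc
    _ = ∫⁻ p : ℝ × E, (({θ ∈ Ico α β | inner ℝ (p.1 • e + (p.2 - inner ℝ e p.2 • e)) (e + u θ) = 0}
          : Set ℝ).encard : ENNReal) ∂(gaussianReal 0 1).prod (stdGaussian E) := by
        conv_lhs => rw [stdGaussian_eq_map_prod he]
        exact lintegral_map hmeas (by fun_prop)
    _ = ∫⁻ f, ∫⁻ θ in Ico α β, ENNReal.ofReal |inner ℝ f (w θ)| *
          gaussianPDF 0 1 (-inner ℝ f (u θ)) ∂volume ∂stdGaussian E := by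
        refine (lintegral_prod_symm' _ (hmeas.comp (by fun_prop : Measurable fun p : ℝ × E =>
          p.1 • e + (p.2 - inner ℝ e p.2 • e)))).trans ?_
        exact lintegral_congr fun f => hfiber f
    _ = ∫⁻ θ in Ico α β, ∫⁻ f, ENNReal.ofReal |inner ℝ f (w θ)| *
          gaussianPDF 0 1 (-inner ℝ f (u θ)) ∂stdGaussian E := by
        refine lintegral_lintegral_swap (Measurable.aemeasurable ?_)
        refine Measurable.mul (by fun_prop) ((measurable_gaussianPDF _ _).comp (by fun_prop))
    _ = _ := by
        simp_rw [hθ]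
        rw [setLIntegral_const, Real.volume_Ico, ← ENNReal.ofReal_mul (by positivity)]
        congr 1
        ring

end Gaussian

/-! ### Calculus of curves through scalar products. -/

section WeakDerivative

variable {E : Type*} [NormedAddCommGroup E] [InnerProductSpace ℝ E] [FiniteDimensional ℝ E]

/-- Finitely many coordinates in an orthonormal basis determine the curve, so weak differentiability
suffices. -/
theorem hasStrictDerivAt_of_inner {u : ℝ → E} {w : E} {θ : ℝ}
    (h : ∀ f : E, HasStrictDerivAt (fun t => inner ℝ f (u t)) (inner ℝ f w) θ) :
    HasStrictDerivAt u w θ := by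
  have hs := HasStrictDerivAt.fun_sum (u := Finset.univ) fun i _ =>
    (h (stdOrthonormalBasis ℝ E i)).smul_const (stdOrthonormalBasis ℝ E i)
  simpa only [OrthonormalBasis.sum_repr'] using hs

theorem continuous_of_inner {u : ℝ → E} (h : ∀ f : E, Continuous fun t => inner ℝ f (u t)) :
    Continuous u := by
  have hs : Continuous fun t => ∑ i, inner ℝ (stdOrthonormalBasis ℝ E i) (u t) •
      stdOrthonormalBasis ℝ E i :=
    continuous_finsetSum _ fun i _ => (h (stdOrthonormalBasis ℝ E i)).smul continuous_const
  simpa only [OrthonormalBasis.sum_repr'] using hs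

end WeakDerivative

/-! ### Fourier coefficients and the evaluation curve. -/

theorem sum_Icc_neg_natCast {M : Type*} [AddCommMonoid M] (h : ℤ → M) (m : ℕ) :
    ∑ k ∈ Finset.Icc (-(m : ℤ)) m, h k =
      h 0 + ∑ j ∈ Finset.range m, (h (j + 1) + h (-(j + 1))) := by
  induction m with
  | zero => simp
  | succ m ih =>
    have : Finset.Icc (-((m + 1 : ℕ) : ℤ)) (m + 1 : ℕ) =
        insert ((m : ℤ) + 1) (insert (-((m : ℤ) + 1)) (Finset.Icc (-(m : ℤ)) m)) := by
      ext k
      simp only [Finset.mem_Icc, Finset.mem_insert]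
      push_cast
      omega
    rw [this, Finset.sum_insert, Finset.sum_insert, ih, Finset.sum_range_succ]
    · rw [← add_assoc, add_comm, add_assoc]
    · simp only [Finset.mem_Icc]; omega
    · simp only [Finset.mem_Icc, Finset.mem_insert]; omega

theorem integral_exp_int_mul (n : ℤ) :
    ∫ θ in (0 : ℝ)..2 * Real.pi, Complex.exp (n * θ * Complex.I) =
      if n = 0 then (2 * Real.pi : ℂ) else 0 := by
  split_ifs with hn
  · simp [hn]
  · have hc : (n * Complex.I : ℂ) ≠ 0 := mul_ne_zero (by exact_mod_cast hn) Complex.I_ne_zero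
    have h := integral_exp_mul_complex (a := 0) (b := 2 * Real.pi) hc
    have h1 : Complex.exp (n * Complex.I * ((2 * Real.pi : ℝ) : ℂ)) = 1 := by
      rw [← Complex.exp_int_mul_two_pi_mul_I n]
      congr 1
      push_cast
      ring
    rw [h1] at h
    simp only [Complex.ofReal_zero, mul_zero, Complex.exp_zero, sub_self, zero_div] at h
    rw [← h]
    congr 1
    funext θ
    congr 1
    ring

namespace realLaurent

variable {m : ℕ}

theorem coeff_eq_zero (f : realLaurent m) {k : ℤ} (hk : k ∉ Finset.Icc (-(m : ℤ)) m) :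
    f.1.coeff k = 0 := by
  by_contra hne
  exact hk (Finset.mem_Icc.2 (abs_le.1 (f.2.1 k (Finsupp.mem_support_iff.2 hne))))

theorem laurentEval_eq_sum (f : realLaurent m) (z : ℂ) :
    laurentEval f z = ∑ k ∈ Finset.Icc (-(m : ℤ)) m, f.1.coeff k * z ^ k := by
  refine Finsupp.sum_of_support_subset _ (fun k hk => ?_) _ (by simp)
  by_contra h
  exact Finsupp.mem_support_iff.1 hk (coeff_eq_zero f h)

theorem exp_zpow (θ : ℝ) (k : ℤ) :
    Complex.exp (θ * Complex.I) ^ k = Complex.exp (k * θ * Complex.I) := by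
  rw [← Complex.exp_int_mul]
  congr 1
  ring

theorem ofReal_trig (f : realLaurent m) (θ : ℝ) :
    (trig f θ : ℂ) = ∑ k ∈ Finset.Icc (-(m : ℤ)) m,
      f.1.coeff k * Complex.exp (k * θ * Complex.I) := by
  have h : (trig f θ : ℂ) = laurentEval f (Complex.exp (θ * Complex.I)) :=
    Complex.ext (by simp [trig]) (by simp [f.2.2 _ (Complex.norm_exp_ofReal_mul_I θ)])
  rw [h, laurentEval_eq_sum]
  simp_rw [exp_zpow]

/-- The scalar product in terms of the coefficients. -/
theorem inner_eq_sum (f g : realLaurent m) :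
    inner ℝ f g = (∑ k ∈ Finset.Icc (-(m : ℤ)) m, f.1.coeff k * conj (g.1.coeff k)).re := by
  have hpi := Real.pi_pos
  have hdef : inner ℝ f g =
      (1 / (2 * Real.pi)) * ∫ θ in (0 : ℝ)..2 * Real.pi, trig f θ * trig g θ := rfl
  have hprod : ∀ θ : ℝ, ((trig f θ * trig g θ : ℝ) : ℂ) =
      ∑ k ∈ Finset.Icc (-(m : ℤ)) m, ∑ l ∈ Finset.Icc (-(m : ℤ)) m,
        f.1.coeff k * conj (g.1.coeff l) * Complex.exp ((k - l : ℤ) * θ * Complex.I) := by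
    intro θ
    -- Since `trig g` is real, it may be conjugated; this pairs equal frequencies instead of
    -- opposite ones.
    have hg : (trig g θ : ℂ) = conj (trig g θ : ℂ) := (Complex.conj_ofReal _).symm
    rw [Complex.ofReal_mul, hg, ofReal_trig, ofReal_trig, map_sum, Finset.sum_mul_sum]
    refine Finset.sum_congr rfl fun k _ => Finset.sum_congr rfl fun l _ => ?_
    have he : Complex.exp ((k - l : ℤ) * θ * Complex.I) =
        Complex.exp (k * θ * Complex.I) * Complex.exp (-(l * θ * Complex.I)) := by
      rw [← Complex.exp_add]
      congr 1
      push_cast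
      ring
    rw [he, map_mul, ← Complex.exp_conj]
    simp only [map_mul, map_intCast, Complex.conj_ofReal, Complex.conj_I, mul_neg]
    ring
  have hint : ((∫ θ in (0 : ℝ)..2 * Real.pi, trig f θ * trig g θ : ℝ) : ℂ) =
      2 * Real.pi * ∑ k ∈ Finset.Icc (-(m : ℤ)) m, f.1.coeff k * conj (g.1.coeff k) := by
    rw [← intervalIntegral.integral_ofReal]
    simp_rw [hprod]
    have hi : ∀ k l : ℤ, IntervalIntegrable (fun θ : ℝ => f.1.coeff k * conj (g.1.coeff l) *
        Complex.exp ((k - l : ℤ) * θ * Complex.I)) volume 0 (2 * Real.pi) := fun k l =>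
      Continuous.intervalIntegrable (by fun_prop) _ _
    rw [intervalIntegral.integral_finsetSum fun k _ =>
      Continuous.intervalIntegrable (by fun_prop) _ _, Finset.mul_sum]
    refine Finset.sum_congr rfl fun k hk => ?_
    rw [intervalIntegral.integral_finsetSum fun l _ => hi k l, Finset.sum_eq_single_of_mem k hk]
    · rw [intervalIntegral.integral_const_mul, integral_exp_int_mul]
      simp
      ring
    · intro l _ hl
      rw [intervalIntegral.integral_const_mul, integral_exp_int_mul,
        if_neg (sub_ne_zero.2 hl.symm), mul_zero]
  have hre := congrArg Complex.re hint
  rw [Complex.ofReal_re, show (2 * Real.pi : ℂ) = ((2 * Real.pi : ℝ) : ℂ) by push_cast; rfl,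
    Complex.re_ofReal_mul] at hre
  rw [hdef, hre]
  field_simp

/-- The real Laurent polynomial of degree at most `m` with given symmetric coefficients. -/
noncomputable def ofCoeff (m : ℕ) (c : ℤ → ℂ) (hc : ∀ k, c (-k) = conj (c k)) : realLaurent m :=
  ⟨AddMonoidAlgebra.ofCoeff
      (Finsupp.onFinset (Finset.Icc (-(m : ℤ)) m) (fun k => if |k| ≤ m then c k else 0)
        fun k hk => Finset.mem_Icc.2 (abs_le.1 (by by_contra h; simp [h] at hk))), by
    refine ⟨fun k hk => ?_, fun z hz => ?_⟩
    · by_contra h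
      simp [h] at hk
    · have heval : laurentEval (AddMonoidAlgebra.ofCoeff (Finsupp.onFinset
          (Finset.Icc (-(m : ℤ)) m) (fun k => if |k| ≤ m then c k else 0)
          fun k hk => Finset.mem_Icc.2 (abs_le.1 (by by_contra h; simp [h] at hk)))) z =
          ∑ k ∈ Finset.Icc (-(m : ℤ)) m, c k * z ^ k := by
        rw [laurentEval, AddMonoidAlgebra.coeff_ofCoeff, Finsupp.onFinset_sum _ (by simp)]
        refine Finset.sum_congr rfl fun k hk => ?_
        rw [if_pos (abs_le.2 (Finset.mem_Icc.1 hk))]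
      rw [heval, ← Complex.conj_eq_iff_im, map_sum]
      -- On the circle `conj z = z⁻¹`, so conjugation exchanges the terms of index `k` and `-k`.
      refine Finset.sum_nbij' (fun k => -k) (fun k => -k) ?_ ?_ (by simp) (by simp) ?_
      · intro k hk; simp only [Finset.mem_Icc] at hk ⊢; omega
      · intro k hk; simp only [Finset.mem_Icc] at hk ⊢; omega
      · intro k _
        rw [hc, map_mul, map_zpow₀, zpow_neg, ← inv_zpow, Complex.inv_eq_conj hz]⟩

theorem coeff_ofCoeff {c : ℤ → ℂ} (hc : ∀ k, c (-k) = conj (c k)) {k : ℤ}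
    (hk : k ∈ Finset.Icc (-(m : ℤ)) m) : (ofCoeff m c hc).1.coeff k = c k := by
  simp [ofCoeff, abs_le.2 (Finset.mem_Icc.1 hk)]

theorem inner_ofCoeff {c : ℤ → ℂ} (hc : ∀ k, c (-k) = conj (c k)) (f : realLaurent m) :
    inner ℝ f (ofCoeff m c hc) =
      (∑ k ∈ Finset.Icc (-(m : ℤ)) m, f.1.coeff k * conj (c k)).re := by
  rw [inner_eq_sum]
  congr 1
  exact Finset.sum_congr rfl fun k hk => by rw [coeff_ofCoeff hc hk]

theorem inner_ofCoeff_ofCoeff {c d : ℤ → ℂ} (hc : ∀ k, c (-k) = conj (c k))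
    (hd : ∀ k, d (-k) = conj (d k)) :
    inner ℝ (ofCoeff m c hc) (ofCoeff m d hd) =
      (∑ k ∈ Finset.Icc (-(m : ℤ)) m, c k * conj (d k)).re := by
  rw [inner_ofCoeff]
  congr 1
  exact Finset.sum_congr rfl fun k hk => by rw [coeff_ofCoeff hc hk]

/-- The constant polynomial `1`. -/
noncomputable def unit (m : ℕ) : realLaurent m :=
  ofCoeff m (fun k => if k = 0 then 1 else 0) (by intro k; by_cases h : k = 0 <;> simp [h])

theorem conj_exp_int_mul (k : ℤ) (θ : ℝ) :
    conj (Complex.exp (-(k * θ * Complex.I))) = Complex.exp (k * θ * Complex.I) := by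
  rw [← Complex.exp_conj]
  simp

/-- The vector that represents evaluation at the angle `θ` of the part without constant term. -/
noncomputable def evalVector (m : ℕ) (θ : ℝ) : realLaurent m :=
  ofCoeff m (fun k => if k = 0 then 0 else Complex.exp (-(k * θ * Complex.I))) (by
    intro k
    by_cases h : k = 0
    · simp [h]
    · simp only [neg_eq_zero, if_neg h, conj_exp_int_mul]
      simp)

/-- The vector that represents the derivative at the angle `θ`. -/
noncomputable def derivVector (m : ℕ) (θ : ℝ) : realLaurent m :=
  ofCoeff m (fun k => -(k * Complex.I) * Complex.exp (-(k * θ * Complex.I))) (by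
    intro k
    rw [map_mul, conj_exp_int_mul]
    simp)

theorem inner_unit (f : realLaurent m) : inner ℝ f (unit m) = (f.1.coeff 0).re := by
  rw [unit, inner_ofCoeff, Finset.sum_eq_single_of_mem 0 (by simp)]
  · simp
  · intro k _ hk
    simp [hk]

theorem inner_evalVector (f : realLaurent m) (θ : ℝ) :
    inner ℝ f (evalVector m θ) = ∑ k ∈ Finset.Icc (-(m : ℤ)) m,
      (f.1.coeff k * (if k = 0 then 0 else Complex.exp (k * θ * Complex.I))).re := by
  rw [evalVector, inner_ofCoeff, Complex.re_sum]
  refine Finset.sum_congr rfl fun k _ => ?_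
  split_ifs
  · simp
  · rw [conj_exp_int_mul]

theorem inner_derivVector (f : realLaurent m) (θ : ℝ) :
    inner ℝ f (derivVector m θ) = ∑ k ∈ Finset.Icc (-(m : ℤ)) m,
      (f.1.coeff k * (k * Complex.I * Complex.exp (k * θ * Complex.I))).re := by
  rw [derivVector, inner_ofCoeff, Complex.re_sum]
  refine Finset.sum_congr rfl fun k _ => ?_
  rw [map_mul, conj_exp_int_mul]
  simp

theorem trig_eq_inner (f : realLaurent m) (θ : ℝ) :
    trig f θ = inner ℝ f (unit m + evalVector m θ) := by
  have h := congrArg Complex.re (ofReal_trig f θ)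
  rw [Complex.ofReal_re, Complex.re_sum] at h
  have h0 : (0 : ℤ) ∈ Finset.Icc (-(m : ℤ)) m := by simp
  rw [inner_add_right, inner_unit, inner_evalVector, h, ← Finset.add_sum_erase _ _ h0,
    ← Finset.add_sum_erase (Finset.Icc (-(m : ℤ)) m) _ h0]
  simp only [Int.cast_zero, zero_mul, Complex.exp_zero, mul_one, if_true, mul_zero,
    Complex.zero_re, zero_add]
  congr 1
  exact Finset.sum_congr rfl fun k hk => by rw [if_neg (Finset.ne_of_mem_erase hk)]

theorem hasStrictDerivAt_evalVector (θ : ℝ) :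
    HasStrictDerivAt (evalVector m) (derivVector m θ) θ := by
  refine hasStrictDerivAt_of_inner fun f => ?_
  simp_rw [inner_evalVector, inner_derivVector]
  refine HasStrictDerivAt.fun_sum fun k _ => ?_
  refine Complex.reCLM.hasStrictFDerivAt.comp_hasStrictDerivAt θ
    (f := fun t : ℝ => f.1.coeff k * (if k = 0 then 0 else Complex.exp (k * t * Complex.I)))
    (f' := f.1.coeff k * (k * Complex.I * Complex.exp (k * θ * Complex.I))) ?_
  refine HasStrictDerivAt.const_mul _ ?_
  by_cases hk : k = 0
  · simpa [hk] using hasStrictDerivAt_const θ (0 : ℂ)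
  · simp only [if_neg hk]
    have h1 : HasStrictDerivAt (fun t : ℝ => (k * t * Complex.I : ℂ)) (k * Complex.I) θ := by
      have := ((Complex.ofRealCLM.hasStrictDerivAt (x := θ)).const_mul (k : ℂ)).mul_const Complex.I
      simpa using this
    rw [mul_comm]
    exact h1.cexp

theorem continuous_derivVector : Continuous (derivVector m) := by
  refine continuous_of_inner fun f => ?_
  simp_rw [inner_derivVector]
  fun_prop

theorem exp_mul_exp_neg_int (k : ℤ) (θ : ℝ) :
    Complex.exp (-(k * θ * Complex.I)) * Complex.exp (k * θ * Complex.I) = 1 := by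
  rw [← Complex.exp_add, neg_add_cancel, Complex.exp_zero]

theorem norm_unit : ‖unit m‖ = 1 := by
  have h : ‖unit m‖ ^ 2 = 1 := by
    rw [← real_inner_self_eq_norm_sq, inner_unit, unit, coeff_ofCoeff _ (by simp)]
    simp
  exact (pow_eq_one_iff_of_nonneg (norm_nonneg _) two_ne_zero).1 h

theorem inner_unit_evalVector (θ : ℝ) : inner ℝ (unit m) (evalVector m θ) = 0 := by
  rw [unit, evalVector, inner_ofCoeff_ofCoeff]
  rw [Finset.sum_eq_zero fun k _ => by by_cases h : k = 0 <;> simp [h], Complex.zero_re]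

theorem norm_evalVector_sq (θ : ℝ) : ‖evalVector m θ‖ ^ 2 = 2 * m := by
  rw [← real_inner_self_eq_norm_sq, evalVector, inner_ofCoeff_ofCoeff, sum_Icc_neg_natCast,
    Finset.sum_congr rfl (g := fun _ => (2 : ℂ))]
  · simp [mul_comm]
  · intro j _
    have h1 : (j : ℤ) + 1 ≠ 0 := by omega
    have h2 : -((j : ℤ) + 1) ≠ 0 := by omega
    rw [if_neg h1, if_neg h2, conj_exp_int_mul, conj_exp_int_mul, exp_mul_exp_neg_int,
      exp_mul_exp_neg_int]
    norm_num

theorem norm_derivVector_sq (θ : ℝ) :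
    ‖derivVector m θ‖ ^ 2 = m * (m + 1) * (2 * m + 1) / 3 := by
  have hterm : ∀ k : ℤ, -(k * Complex.I) * Complex.exp (-(k * θ * Complex.I)) *
      conj (-(k * Complex.I) * Complex.exp (-(k * θ * Complex.I))) = ((k ^ 2 : ℤ) : ℂ) := by
    intro k
    rw [map_mul, conj_exp_int_mul]
    have h := exp_mul_exp_neg_int k θ
    simp only [map_neg, map_mul, map_intCast, Complex.conj_I, mul_neg, neg_neg]
    push_cast
    linear_combination (-(k : ℂ) ^ 2 * Complex.I ^ 2) * h + (-(k : ℂ) ^ 2) * Complex.I_sq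
  have hsum : ∀ n : ℕ, ∑ j ∈ Finset.range n, (((j : ℝ) + 1) ^ 2 + (-((j : ℝ) + 1)) ^ 2) =
      (n : ℝ) * (n + 1) * (2 * n + 1) / 3 := by
    intro n
    induction n with
    | zero => simp
    | succ n ih =>
      rw [Finset.sum_range_succ, ih]
      push_cast
      ring
  rw [← real_inner_self_eq_norm_sq, derivVector, inner_ofCoeff_ofCoeff]
  simp_rw [hterm]
  rw [← Int.cast_sum, Complex.intCast_re, sum_Icc_neg_natCast, ← hsum]
  push_cast
  ring

/-- The exponentials cancel, and each frequency contributes the purely imaginary number `k i`. -/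
theorem inner_evalVector_derivVector (θ : ℝ) :
    inner ℝ (evalVector m θ) (derivVector m θ) = 0 := by
  rw [evalVector, derivVector, inner_ofCoeff_ofCoeff, Complex.re_sum]
  refine Finset.sum_eq_zero fun k _ => ?_
  by_cases hk : k = 0
  · simp [hk]
  · rw [if_neg hk, map_mul, conj_exp_int_mul, mul_left_comm, exp_mul_exp_neg_int]
    simp

/-- The expected number of zeros of a random trigonometric polynomial. -/
theorem lintegral_encard_trig_zeros (hm : 1 ≤ m) :
    ∫⁻ f : realLaurent m, (({θ ∈ Ico 0 (2 * Real.pi) | trig f θ = 0} : Set ℝ).encard : ENNReal)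
      ∂randomLaurent m = ENNReal.ofReal (2 * Real.sqrt ((m : ℝ) * (m + 1) / 3)) := by
  have hm' : (0 : ℝ) < m := by exact_mod_cast hm
  have hpi := Real.pi_pos
  simp_rw [trig_eq_inner]
  rw [lintegral_encard_zeros_stdGaussian norm_unit hasStrictDerivAt_evalVector
    continuous_derivVector inner_unit_evalVector (by positivity) norm_evalVector_sq
    norm_derivVector_sq inner_evalVector_derivVector]
  -- The factor `2m + 1` of `W` cancels against `1 + U`.
  congr 2
  · field_simp
    ring
  · congr 1
    field_simp
    ring

end realLaurent

/-! ### Number and simplicity of the complex roots. -/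

/-- The polynomial `z ^ m * ∑ cₖ zᵏ`, the sum over `-m ≤ k ≤ m`. -/
noncomputable def shiftedPolynomial (m : ℕ) (c : ℤ → ℂ) : Polynomial ℂ :=
  ∑ j ∈ Finset.range (2 * m + 1), Polynomial.monomial j (c (j - m))

theorem coeff_shiftedPolynomial (m : ℕ) (c : ℤ → ℂ) (j : ℕ) :
    (shiftedPolynomial m c).coeff j = if j ≤ 2 * m then c (j - m) else 0 := by
  simp only [shiftedPolynomial, Polynomial.finsetSum_coeff, Polynomial.coeff_monomial,
    Finset.sum_ite_eq', Finset.mem_range, Nat.lt_succ_iff]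

theorem eval_shiftedPolynomial (m : ℕ) (c : ℤ → ℂ) {z : ℂ} (hz : z ≠ 0) :
    (shiftedPolynomial m c).eval z = z ^ m * ∑ k ∈ Finset.Icc (-(m : ℤ)) m, c k * z ^ k := by
  rw [shiftedPolynomial, Polynomial.eval_finsetSum, Finset.mul_sum]
  refine Finset.sum_bij' (fun j _ => (j : ℤ) - m) (fun k _ => (k + m).toNat) ?_ ?_ ?_ ?_ ?_
  · intro j hj; simp only [Finset.mem_range, Finset.mem_Icc] at hj ⊢; omega
  · intro k hk; simp only [Finset.mem_range, Finset.mem_Icc] at hk ⊢; omega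
  · intro j _; simp
  · intro k hk; simp only [Finset.mem_Icc] at hk; omega
  · intro j _
    rw [Polynomial.eval_monomial, zpow_sub₀ hz, zpow_natCast, zpow_natCast]
    field_simp

theorem finite_zeros_of_coeff_ne_zero {m : ℕ} {c : ℤ → ℂ} (hc : c m ≠ 0) :
    {z : ℂ | z ≠ 0 ∧ ∑ k ∈ Finset.Icc (-(m : ℤ)) m, c k * z ^ k = 0}.Finite := by
  have hp : shiftedPolynomial m c ≠ 0 := by
    intro h
    have h2 := coeff_shiftedPolynomial m c (2 * m)
    rw [h, if_pos le_rfl, Polynomial.coeff_zero] at h2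
    push_cast at h2
    rw [two_mul, add_sub_cancel_right] at h2
    exact hc h2.symm
  refine (Polynomial.finite_setOfPred_isRoot hp).subset fun z hz => ?_
  rw [mem_ofPred_eq, Polynomial.IsRoot, eval_shiftedPolynomial m c hz.1, hz.2, mul_zero]

namespace realLaurent

variable {m : ℕ}

/-- Conjugate the Fourier integral of the real function `trig f`. -/
theorem coeff_neg (f : realLaurent m) {k : ℤ} (hk : k ∈ Finset.Icc (-(m : ℤ)) m) :
    f.1.coeff (-k) = conj (f.1.coeff k) := by
  have hfourier : ∀ k ∈ Finset.Icc (-(m : ℤ)) m,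
      ∫ θ in (0 : ℝ)..2 * Real.pi, (trig f θ : ℂ) * Complex.exp (-(k * θ * Complex.I)) =
        2 * Real.pi * f.1.coeff k := by
    intro k hk
    have hprod : ∀ θ : ℝ, (trig f θ : ℂ) * Complex.exp (-(k * θ * Complex.I)) =
        ∑ l ∈ Finset.Icc (-(m : ℤ)) m,
          f.1.coeff l * Complex.exp ((l - k : ℤ) * θ * Complex.I) := by
      intro θ
      rw [ofReal_trig, Finset.sum_mul]
      refine Finset.sum_congr rfl fun l _ => ?_
      rw [mul_assoc, ← Complex.exp_add]
      push_cast
      ring_nf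
    simp_rw [hprod]
    rw [intervalIntegral.integral_finsetSum fun l _ =>
      Continuous.intervalIntegrable (by fun_prop) _ _, Finset.sum_eq_single_of_mem k hk]
    · rw [intervalIntegral.integral_const_mul, integral_exp_int_mul]
      simp [mul_comm]
    · intro l _ hl
      rw [intervalIntegral.integral_const_mul, integral_exp_int_mul,
        if_neg (sub_ne_zero.2 hl), mul_zero]
  have hk' : -k ∈ Finset.Icc (-(m : ℤ)) m := by
    simp only [Finset.mem_Icc] at hk ⊢; omega
  have h1 := congrArg conj (hfourier k hk)
  rw [← intervalIntegral.intervalIntegral_conj] at h1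
  have h2 := hfourier (-k) hk'
  simp only [map_mul, conj_exp_int_mul, Complex.conj_ofReal, map_ofNat] at h1
  simp only [Int.cast_neg, neg_mul, neg_neg] at h2
  have hpi : (2 * Real.pi : ℂ) ≠ 0 := by simp [Real.pi_ne_zero]
  exact mul_left_cancel₀ hpi (h2.symm.trans h1)

theorem ae_coeff_ne_zero (m : ℕ) : ∀ᵐ f ∂randomLaurent m, f.1.coeff m ≠ 0 := by
  -- The scalar product with this vector involves only the coefficients of index `±m`, and by
  -- symmetry these vanish together.
  let c : ℤ → ℂ := fun k => if |k| = m then 1 else 0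
  have hc : ∀ k, c (-k) = conj (c k) := by
    intro k
    by_cases h : |k| = m <;> simp [c, h]
  have hmem : (m : ℤ) ∈ Finset.Icc (-(m : ℤ)) m := by simp
  have hw : ofCoeff m c hc ≠ 0 := by
    intro h
    have h1 := coeff_ofCoeff hc hmem
    rw [h] at h1
    simp [c] at h1
  filter_upwards [stdGaussian_inner_ne_zero hw] with f hf hfm
  have hfm' : f.1.coeff (-m) = 0 := by rw [coeff_neg f hmem, hfm, map_zero]
  refine hf ?_
  rw [inner_ofCoeff, Finset.sum_eq_zero, Complex.zero_re]
  intro k _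
  by_cases h : |k| = m
  · rcases abs_choice k with hk | hk
    · rw [← hk, h, hfm, zero_mul]
    · rw [show k = -m by omega, hfm', zero_mul]
  · simp [c, h]

/-- The value at `z` of `z f'(z)`. -/
noncomputable def eulerEval (f : realLaurent m) (z : ℂ) : ℂ :=
  ∑ k ∈ Finset.Icc (-(m : ℤ)) m, k * f.1.coeff k * z ^ k

theorem hasDerivAt_laurentEval (f : realLaurent m) {z : ℂ} (hz : z ≠ 0) :
    HasDerivAt (laurentEval f) (eulerEval f z / z) z := by
  have hfun : laurentEval (f : ℂ[T;T⁻¹]) =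
      fun z => ∑ k ∈ Finset.Icc (-(m : ℤ)) m, f.1.coeff k * z ^ k :=
    funext (laurentEval_eq_sum f)
  rw [hfun, eulerEval, Finset.sum_div]
  refine HasDerivAt.fun_sum fun k _ => ?_
  refine ((hasDerivAt_zpow k z (Or.inl hz)).const_mul (f.1.coeff k)).congr_deriv ?_
  rw [zpow_sub_one₀ hz]
  field_simp

theorem analyticAt_laurentEval (f : realLaurent m) {z : ℂ} (hz : z ≠ 0) :
    AnalyticAt ℂ (laurentEval f) z := by
  refine DifferentiableOn.analyticAt (s := {0}ᶜ) (fun w hw => ?_)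
    (isOpen_compl_singleton.mem_nhds hz)
  exact (hasDerivAt_laurentEval f hw).differentiableAt.differentiableWithinAt

theorem continuous_coeff (k : ℤ) : Continuous fun f : realLaurent m => f.1.coeff k := by
  let φ : realLaurent m →ₗ[ℝ] ℂ :=
    { toFun := fun f => f.1.coeff k
      map_add' := fun f g => by simp
      map_smul' := fun c f => by simp }
  exact φ.continuous_of_finiteDimensional

theorem isClosed_exists_multiple_root {K : Set ℂ} (hK : IsCompact K) (h0 : (0 : ℂ) ∉ K) :
    IsClosed {f : realLaurent m | ∃ z ∈ K, (laurentEval f z, eulerEval f z) = (0, 0)} := by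
  refine isClosed_setOf_exists_mem_isCompact (F := fun (f : realLaurent m) z =>
    (laurentEval f z, eulerEval f z)) hK ?_ _
  simp_rw [laurentEval_eq_sum, eulerEval]
  have hz : ∀ k : ℤ, ContinuousOn (fun p : realLaurent m × ℂ => p.2 ^ k) (univ ×ˢ K) := fun k =>
    continuousOn_snd.zpow₀ k fun p hp => Or.inl fun h => h0 (h ▸ hp.2)
  have hc : ∀ k : ℤ, ContinuousOn (fun p : realLaurent m × ℂ => p.1.1.coeff k) (univ ×ˢ K) :=
    fun k => ((continuous_coeff k).comp continuous_fst).continuousOn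
  exact (continuousOn_finsetSum _ fun k _ => (hc k).mul (hz k)).prodMk
    (continuousOn_finsetSum _ fun k _ => (continuousOn_const.mul (hc k)).mul (hz k))

theorem measurableSet_exists_multiple_root (m : ℕ) :
    MeasurableSet {f : realLaurent m | ∃ z ≠ 0, laurentEval f z = 0 ∧ eulerEval f z = 0} := by
  -- Compact annuli exhausting `ℂ ∖ 0`; they avoid `0`, where negative powers are not continuous.
  let K : ℕ → Set ℂ := fun n => Metric.closedBall 0 n \ Metric.ball 0 (1 / (n + 1))
  have hK : ∀ n, IsCompact (K n) := fun n => (isCompact_closedBall 0 _).diff Metric.isOpen_ball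
  have h0 : ∀ n, (0 : ℂ) ∉ K n := fun n h => h.2 (Metric.mem_ball_self (by positivity))
  have heq : {f : realLaurent m | ∃ z ≠ 0, laurentEval f z = 0 ∧ eulerEval f z = 0} =
      ⋃ n, {f : realLaurent m | ∃ z ∈ K n, (laurentEval f z, eulerEval f z) = (0, 0)} := by
    ext f
    simp only [mem_ofPred_eq, mem_iUnion, Prod.mk.injEq]
    constructor
    · rintro ⟨z, hz, h⟩
      have hev : ∀ᶠ n : ℕ in Filter.atTop, ‖z‖ ≤ n :=
        tendsto_natCast_atTop_atTop.eventually_ge_atTop _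
      have hev' : ∀ᶠ n : ℕ in Filter.atTop, 1 / ((n : ℝ) + 1) < ‖z‖ :=
        tendsto_one_div_add_atTop_nhds_zero_nat.eventually_lt_const (norm_pos_iff.2 hz)
      obtain ⟨n, h1, h2⟩ := (hev.and hev').exists
      exact ⟨n, z, ⟨by simpa using h1, by simpa using h2.le⟩, h⟩
    · rintro ⟨n, z, hz, h⟩
      exact ⟨z, fun hz0 => h0 n (hz0 ▸ hz), h⟩
  rw [heq]
  exact MeasurableSet.iUnion fun n => (isClosed_exists_multiple_root (hK n) (h0 n)).measurableSet

theorem laurentEval_unit_eq_one (z : ℂ) : laurentEval (unit m : ℂ[T;T⁻¹]) z = 1 := by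
  rw [laurentEval_eq_sum, Finset.sum_eq_single_of_mem 0 (by simp)]
  · rw [unit, coeff_ofCoeff _ (by simp)]; simp
  · intro k hk hk0
    rw [unit, coeff_ofCoeff _ hk, if_neg hk0, zero_mul]

theorem eulerEval_add_smul_unit (f : realLaurent m) (a b : ℝ) (z : ℂ) :
    eulerEval (a • unit m + (f - b • unit m)) z = eulerEval f z := by
  refine Finset.sum_congr rfl fun k hk => ?_
  by_cases hk0 : k = 0
  · simp [hk0]
  · have : (unit m).1.coeff k = 0 := by rw [unit, coeff_ofCoeff _ hk, if_neg hk0]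
    simp [this]

/-- Almost surely, a random real Laurent polynomial has only simple roots. -/
theorem ae_roots_simple (hm : 1 ≤ m) :
    ∀ᵐ f : realLaurent m ∂randomLaurent m, ¬ ∃ z ≠ 0, laurentEval f z = 0 ∧ eulerEval f z = 0 := by
  have hS := measurableSet_exists_multiple_root m
  have hmap : Measurable fun p : ℝ × realLaurent m =>
      p.1 • unit m + (p.2 - inner ℝ (unit m) p.2 • unit m) := by fun_prop
  have hsingle := nullSingletonClass_gaussianReal (μ := 0) (v := 1) one_ne_zero
  rw [ae_iff]
  simp only [not_not]
  rw [randomLaurent, stdGaussian_eq_map_prod (norm_unit (m := m)),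
    Measure.map_apply hmap hS, Measure.prod_apply_symm (hmap hS), lintegral_eq_zero_iff'
    (measurable_measure_prodMk_right (hmap hS)).aemeasurable]
  filter_upwards [ae_coeff_ne_zero m] with f hf
  let g : realLaurent m := f - inner ℝ (unit m) f • unit m
  have hfin : {z : ℂ | z ≠ 0 ∧ eulerEval f z = 0}.Finite := by
    refine finite_zeros_of_coeff_ne_zero (c := fun k => k * f.1.coeff k) (mul_ne_zero ?_ hf)
    exact_mod_cast (by omega : m ≠ 0)
  -- A multiple root `z` is one of finitely many zeros of `eulerEval f` and forces `a = -g(z)`: a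
  -- finite set of `a`, null for the normal law.
  refine measure_mono_null ?_
    ((hfin.image fun z => (-laurentEval (g : ℂ[T;T⁻¹]) z).re).measure_zero _)
  rintro a ⟨z, hz, h1, h2⟩
  refine ⟨z, ⟨hz, by rwa [eulerEval_add_smul_unit] at h2⟩, ?_⟩
  have h3 : (a : ℂ) + laurentEval (g : ℂ[T;T⁻¹]) z = 0 := by
    rw [← h1, Submodule.coe_add, laurentEval_add, Submodule.coe_smul, laurentEval_smul,
      laurentEval_unit_eq_one, mul_one]
  simp [← eq_neg_of_add_eq_zero_left h3]

/-- A real Laurent polynomial of degree exactly `m` whose roots are simple has `2 m` roots. -/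
theorem ncard_laurentRoots {f : realLaurent m} (hf : f.1.coeff m ≠ 0)
    (hs : ¬ ∃ z ≠ 0, laurentEval f z = 0 ∧ eulerEval f z = 0) :
    (laurentRoots f).ncard = 2 * m := by
  let p := shiftedPolynomial m f.1.coeff
  have heval : ∀ z ≠ 0, p.eval z = z ^ m * laurentEval f z := fun z hz => by
    rw [eval_shiftedPolynomial m _ hz, laurentEval_eq_sum]
  have hlead : p.coeff (2 * m) ≠ 0 := by
    rw [coeff_shiftedPolynomial, if_pos le_rfl]
    push_cast
    rwa [two_mul, add_sub_cancel_right]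
  have hdeg : p.natDegree = 2 * m := by
    refine Polynomial.natDegree_eq_of_le_of_coeff_ne_zero ?_ hlead
    refine Polynomial.natDegree_le_iff_coeff_eq_zero.2 fun j hj => ?_
    rw [coeff_shiftedPolynomial, if_neg (not_le.2 hj)]
  have hp : p ≠ 0 := fun h => hlead (by rw [h, Polynomial.coeff_zero])
  -- The constant term of `p` is the conjugate of its leading coefficient, so no root is lost at
  -- `0`.
  have hroot0 : p.eval 0 ≠ 0 := by
    rw [← Polynomial.coeff_zero_eq_eval_zero, coeff_shiftedPolynomial, if_pos (Nat.zero_le _),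
      Nat.cast_zero, zero_sub, coeff_neg f (by simp)]
    exact (map_ne_zero _).2 hf
  have hroots : ∀ z, z ∈ p.roots ↔ z ∈ laurentRoots f := by
    intro z
    rw [Polynomial.mem_roots hp, Polynomial.IsRoot]
    by_cases hz : z = 0
    · subst hz
      exact ⟨fun h => absurd h hroot0, fun h => absurd rfl h.1⟩
    · rw [heval z hz]
      exact ⟨fun h => ⟨hz, (mul_eq_zero.1 h).resolve_left (pow_ne_zero m hz)⟩,
        fun h => by rw [h.2, mul_zero]⟩
  have hnodup : p.roots.Nodup := by
    rw [Multiset.nodup_iff_count_le_one]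
    intro z
    rw [Polynomial.count_roots]
    by_contra! hlt
    obtain ⟨h1, h2⟩ := (Polynomial.one_lt_rootMultiplicity_iff_isRoot hp).1 hlt
    obtain ⟨hz, hz0⟩ := (hroots z).1 ((Polynomial.mem_roots hp).2 h1)
    -- At a root, the derivative of `z ^ m f(z)` is `z ^ m f'(z)`, so a multiple root of `p` is one
    -- of `f`.
    have hd : HasDerivAt (fun w => w ^ m * laurentEval f w)
        (m * z ^ (m - 1) * laurentEval f z + z ^ m * (eulerEval f z / z)) z :=
      (hasDerivAt_pow m z).mul (hasDerivAt_laurentEval f hz)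
    have hd' := hd.congr_of_eventuallyEq (f₁ := fun w => p.eval w) (by
      filter_upwards [isOpen_compl_singleton.mem_nhds hz] with w hw using heval w hw)
    have heq := hd'.unique (p.hasDerivAt z)
    rw [h2.eq_zero, hz0, mul_zero, zero_add] at heq
    refine hs ⟨z, hz, hz0, ?_⟩
    have := (mul_eq_zero.1 heq).resolve_left (pow_ne_zero m hz)
    exact (div_eq_zero_iff.1 this).resolve_right hz
  have hset : laurentRoots f = (p.roots.toFinset : Set ℂ) := by
    ext z
    rw [Finset.mem_coe, Multiset.mem_toFinset, hroots]
  rw [hset, ncard_coe_finset, Multiset.toFinset_card_of_nodup hnodup,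
    IsAlgClosed.card_roots_eq_natDegree, hdeg]

theorem countRoots_eq_ncard {f : realLaurent m}
    (hs : ¬ ∃ z ≠ 0, laurentEval f z = 0 ∧ eulerEval f z = 0) {R : Set ℂ}
    (hR : R ⊆ laurentRoots f) (c : RootCounting) : countRoots f R c = R.ncard := by
  cases c with
  | distinct => rfl
  | withMultiplicity =>
    have h1 : ∀ z ∈ R, analyticOrderNatAt (laurentEval f) z = 1 := by
      intro z hz
      obtain ⟨hz0, hfz⟩ := hR hz
      have hd : deriv (laurentEval f) z ≠ 0 := by
        rw [(hasDerivAt_laurentEval f hz0).deriv]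
        exact div_ne_zero (fun h => hs ⟨z, hz0, hfz, h⟩) hz0
      rw [analyticOrderNatAt,
        (analyticAt_laurentEval f hz0).analyticOrderAt_eq_one_of_zero_deriv_ne_zero
        hfz hd]
      rfl
    rw [countRoots, finsum_mem_congr rfl h1, finsum_one]

theorem encard_laurentRealRoots (f : realLaurent m) :
    (laurentRealRoots f).encard = ({θ ∈ Ico 0 (2 * Real.pi) | trig f θ = 0} : Set ℝ).encard := by
  have himage : laurentRealRoots f = circleMap 0 1 '' {θ ∈ Ico 0 (2 * Real.pi) | trig f θ = 0} := by
    have htrig : ∀ θ, laurentEval f (circleMap 0 1 θ) = trig f θ := fun θ => by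
      rw [ofReal_trig, laurentEval_eq_sum]
      simp only [circleMap, Complex.ofReal_one, one_mul, zero_add, exp_zpow]
    ext z
    constructor
    · rintro ⟨⟨-, hz⟩, hz1⟩
      have hz' : z ∈ circleMap 0 1 '' Ico 0 (2 * Real.pi) := by
        have hr : z ∈ range (circleMap 0 1) := by
          rw [range_circleMap]
          simpa using hz1
        obtain ⟨t, rfl⟩ := hr
        obtain ⟨θ, hθ, h⟩ := (periodic_circleMap 0 1).exists_mem_Ico₀ Real.two_pi_pos t
        exact ⟨θ, hθ, h.symm⟩
      obtain ⟨θ, hθ, rfl⟩ := hz'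
      rw [htrig] at hz
      exact ⟨θ, ⟨hθ, by exact_mod_cast hz⟩, rfl⟩
    · rintro ⟨θ, ⟨-, hθ⟩, rfl⟩
      refine ⟨⟨circleMap_ne_center one_ne_zero, ?_⟩, by simp⟩
      rw [htrig, hθ, Complex.ofReal_zero]
  rw [himage, InjOn.encard_image]
  exact (injOn_circleMap_of_abs_sub_le' one_ne_zero (by simp)).mono fun θ hθ => hθ.1

end realLaurent

/-! ### Expectation, probability and limit. -/

namespace realLaurent

/-- The right side is known to be measurable and its mean is computed, which gives integrability of
the left side for either way of counting. -/
theorem ae_countRoots_real_eq {m : ℕ} (hm : 1 ≤ m) (c : RootCounting) :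
    (fun f : realLaurent m => (countRoots f (laurentRealRoots f) c : ℝ)) =ᵐ[randomLaurent m]
      fun f => (({θ ∈ Ico 0 (2 * Real.pi) | trig f θ = 0} : Set ℝ).encard : ENNReal).toReal := by
  filter_upwards [ae_roots_simple hm] with f hf
  rw [countRoots_eq_ncard hf (fun z hz => hz.1), ← encard_laurentRealRoots, ncard_def]
  -- An infinite set causes no mismatch: `ncard` and `toReal` both give `0`.
  cases (laurentRealRoots f).encard <;> simp

theorem countRoots_real_degree_zero {f : realLaurent 0} (hf : f.1.coeff 0 ≠ 0)
    (c : RootCounting) : countRoots f (laurentRealRoots f) c = 0 := by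
  have : laurentRealRoots f = ∅ := by
    refine eq_empty_of_forall_notMem fun z hz => hf ?_
    have h := hz.1.2
    rw [laurentEval_eq_sum] at h
    simpa using h
  rw [this]
  cases c <;> simp [countRoots]

theorem integrable_integral_countRoots_real (m : ℕ) (c : RootCounting) :
    Integrable (fun f : realLaurent m => (countRoots f (laurentRealRoots f) c : ℝ))
        (randomLaurent m) ∧
      ∫ f : realLaurent m, (countRoots f (laurentRealRoots f) c : ℝ) ∂randomLaurent m =
        2 * Real.sqrt ((m : ℝ) * (m + 1) / 3) := by
  rcases Nat.eq_zero_or_pos m with rfl | hm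
  · have h0 : (fun f : realLaurent 0 => (countRoots f (laurentRealRoots f) c : ℝ))
        =ᵐ[randomLaurent 0] 0 := by
      filter_upwards [ae_coeff_ne_zero 0] with f hf
      rw [countRoots_real_degree_zero hf, Nat.cast_zero, Pi.zero_apply]
    refine ⟨(integrable_zero _ _ _).congr h0.symm, ?_⟩
    rw [integral_congr_ae h0]
    simp
  · have hae := ae_countRoots_real_eq hm c
    have hlint := lintegral_encard_trig_zeros hm
    have hfin : ∫⁻ f : realLaurent m,
        (({θ ∈ Ico 0 (2 * Real.pi) | trig f θ = 0} : Set ℝ).encard : ENNReal)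
          ∂randomLaurent m ≠ ⊤ := by
      rw [hlint]
      exact ENNReal.ofReal_ne_top
    have hu : Continuous (evalVector m) :=
      continuous_iff_continuousAt.2 fun θ =>
        (hasStrictDerivAt_evalVector θ).hasDerivAt.continuousAt
    have hmeas : Measurable fun f : realLaurent m =>
        (({θ ∈ Ico 0 (2 * Real.pi) | trig f θ = 0} : Set ℝ).encard : ENNReal) := by
      refine measurable_encard_zeros (F := fun (f : realLaurent m) θ => trig f θ) ?_ _ _
      simp_rw [trig_eq_inner]
      fun_prop
    refine ⟨(integrable_toReal_of_lintegral_ne_top hmeas.aemeasurable hfin).congr hae.symm, ?_⟩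
    rw [integral_congr_ae hae, integral_toReal hmeas.aemeasurable
      (ae_lt_top hmeas hfin), hlint, ENNReal.toReal_ofReal (by positivity)]

theorem realRootProbability_eq {m : ℕ} (hm : 1 ≤ m) (c : RootCounting) :
    realRootProbability m c = Real.sqrt (((m : ℝ) + 1) / (3 * m)) := by
  have hm' : (0 : ℝ) < m := by exact_mod_cast hm
  have hae : (fun f : realLaurent m => (countRoots f (laurentRealRoots f) c : ℝ) /
      countRoots f (laurentRoots f) c) =ᵐ[randomLaurent m]
      fun f => (countRoots f (laurentRealRoots f) c : ℝ) / (2 * m) := by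
    filter_upwards [ae_roots_simple hm, ae_coeff_ne_zero m] with f hf hfm
    rw [countRoots_eq_ncard hf subset_rfl, ncard_laurentRoots hfm hf]
    push_cast
    rfl
  rw [realRootProbability, integral_congr_ae hae, integral_div,
    (integrable_integral_countRoots_real m c).2, mul_div_mul_left _ _ two_ne_zero,
    div_eq_iff hm'.ne']
  conv_rhs => rw [← Real.sqrt_sq hm'.le, ← Real.sqrt_mul (by positivity)]
  congr 1
  rw [Real.sqrt_sq hm'.le]
  field_simp

end realLaurent

theorem theorem2 (c : RootCounting) :
    (∀ m : ℕ,
      MeasureTheory.Integrable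
        (fun f : realLaurent m => (countRoots f (laurentRealRoots f) c : ℝ)) (randomLaurent m) ∧
      ∫ f : realLaurent m, (countRoots f (laurentRealRoots f) c : ℝ) ∂randomLaurent m =
        2 * Real.sqrt ((m : ℝ) * (m + 1) / 3)) ∧
    (∀ m : ℕ, 1 ≤ m → realRootProbability m c = Real.sqrt (((m : ℝ) + 1) / (3 * m))) ∧
    Filter.Tendsto (fun m : ℕ => realRootProbability m c) Filter.atTop
      (nhds (1 / Real.sqrt 3)) := by
  refine ⟨fun m => realLaurent.integrable_integral_countRoots_real m c,
    fun m hm => realLaurent.realRootProbability_eq hm c, ?_⟩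
  have hlim : Filter.Tendsto (fun m : ℕ => Real.sqrt (1 / 3 + 1 / 3 * (1 / (m : ℝ)))) Filter.atTop
      (nhds (Real.sqrt (1 / 3 + 1 / 3 * 0))) :=
    ((tendsto_one_div_atTop_nhds_zero_nat.const_mul _).const_add _).sqrt
  rw [mul_zero, add_zero, Real.sqrt_div zero_le_one, Real.sqrt_one] at hlim
  refine hlim.congr' ?_
  filter_upwards [Filter.eventually_ge_atTop 1] with m hm
  have hm' : (m : ℝ) ≠ 0 := by exact_mod_cast (by omega : m ≠ 0)
  rw [realLaurent.realRootProbability_eq hm c]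
  congr 1
  field_simp
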